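/- **Conventions.** A filter on a set $A$ is a proper filter ($\emptyset$ is not a member). For a filter $\mathcal F$ on $A$, let $\mathcal F^+$ be the family of all $X\subseteq A$ that meet every member of $\mathcal F$, and for $X\in\mathcal F^+$ let $\mathcal F\restriction X=\{S\cap X: S\in\mathcal F\}$, a filter on $X$. Two filters are *isomorphic* if some bijection between their underlying sets carries one onto the other. $\mathcal F$ is *homogeneous* if $\mathcal F\restriction X$ is isomorphic to $\mathcal F$ for every $X\in\mathcal F^+$. For a filter $\mathcal F$ on $\omega$, $\mathcal F\times\omega$ is the filter on $\omega\times\omega$ generated by the sets $S\times\omega$, $S\in\mathcal F$. For a topological space $X$ put $X^0=X$, let $X^{\alpha+1}$ be the set of non-isolated points of $X^\alpha$, and $X^\alpha=\bigcap_{\beta<\alpha}X^\beta$ for limit $\alpha$. $X$ is *scattered* if $X^\alpha=\emptyset$ for some $\alpha$; its *rank* is then the least such $\alpha$. $X$ is an *$\alpha$-Toronto space* if it is scattered of rank $\alpha$ and is homeomorphic to each of its subspaces of rank $\alpha$. Given a filter $\mathcal F$ on $\omega$, define spaces $T_\alpha$ by recursion on the ordinal $\alpha$. $T_0$ is empty.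 $T_{\alpha+1}$ is the set $\{\infty\}\cup\bigcup_{n\in\omega}(\{n\}\times T_\alpha)$, in which each $\{n\}\times T_\alpha$ is an open subspace carrying the topology of $T_\alpha$, and the sets $\{\infty\}\cup\bigcup_{n\in S}(\{n\}\times T_\alpha)$, $S\in\mathcal F$, form a neighbourhood base at $\infty$ (so $T_1$ is a single point). For limit $\alpha$, $T_\alpha$ is the topological sum $\bigoplus_{\beta<\alpha}T_\beta$. **Theorem 2.11.** Let $\mathcal F$ be a filter on $\omega$ that is homogeneous, isomorphic to $\mathcal F\times\omega$, and satisfies $(*)$ whenever $f:\omega\to\omega$ is unbounded on every $S\in\mathcal F$, there is some $A\in\mathcal F^+$ such that $f\restriction A$ is finite-to-one. Then for every $\alpha<\omega_1$, $T_\alpha$ is a countable $\alpha$-Toronto space, and for every $\beta<\alpha$, each subspace of $T_\alpha$ of rank $\beta$ is homeomorphic to a topological sum of countably many (possibly finitely many) copies of $T_\beta$. -/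

import Mathlib

open Set Filter Topology

namespace TorontoSpaces

/-- An isomorphism of filters: a bijection of the underlying sets carrying one filter to the
other. -/
def FilterIso {A B : Type*} (F : Filter A) (G : Filter B) : Prop :=
  ∃ e : A ≃ B, Filter.map e F = G

/-- The `F`-positive sets (the family written `F⁺`): those that meet every member of `F`. -/
def Positive {A : Type*} (F : Filter A) (X : Set A) : Prop :=
  ∀ S ∈ F, (X ∩ S).Nonempty

/-- The restriction of `F` to `X`, a filter on `X`; its members are the sets `S ∩ X`, `S ∈ F`. -/
def restrict {A : Type*} (F : Filter A) (X : Set A) : Filter X :=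
  Filter.comap (Subtype.val : X → A) F

/-- A filter is homogeneous if its restriction to each positive set is isomorphic to it. -/
def Homogeneous {A : Type*} (F : Filter A) : Prop :=
  ∀ X : Set A, Positive F X → FilterIso (restrict F X) F

/-- The filter `F × ω` on `ω × ω`, generated by the sets `S × ω` with `S ∈ F`. -/
def timesOmega (F : Filter ℕ) : Filter (ℕ × ℕ) :=
  Filter.comap (Prod.fst : ℕ × ℕ → ℕ) F

/-- Each `f : ω → ω` that is unbounded on every member of `F` is finite-to-one on some positive
set. -/
def FiniteToOneCondition (F : Filter ℕ) : Prop :=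
  ∀ f : ℕ → ℕ, (∀ S ∈ F, ¬ BddAbove (f '' S)) →
    ∃ A : Set ℕ, Positive F A ∧ ∀ m : ℕ, {n | n ∈ A ∧ f n = m}.Finite

/-- The underlying set of `(X_n)_n ∪_F {∞}`: the disjoint union of the `X n` and one more point
`∞`. -/
inductive FilterSum.{u} (F : Filter ℕ) (X : ℕ → Type u) : Type u
  | infty : FilterSum F X
  | pt (n : ℕ) (x : X n) : FilterSum F X

/-- The topology of `(X_n)_n ∪_F {∞}`: a set is open iff its trace on each `X n` is open and, in
case it contains `∞`, it contains `⋃_{n ∈ S} X n` for some `S ∈ F`. -/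
instance FilterSum.instTopologicalSpace (F : Filter ℕ) (X : ℕ → Type*)
    [∀ n, TopologicalSpace (X n)] : TopologicalSpace (FilterSum F X) where
  IsOpen U := (∀ n, IsOpen {x : X n | FilterSum.pt n x ∈ U}) ∧
    (FilterSum.infty ∈ U →
      ∃ S ∈ F, ∀ n ∈ S, ∀ x : X n, FilterSum.pt n x ∈ U)
  isOpen_univ := ⟨fun _ => isOpen_univ, fun _ => ⟨univ, univ_mem, fun _ _ _ => mem_univ _⟩⟩
  isOpen_inter U V hU hV := by
    refine ⟨fun n => (hU.1 n).inter (hV.1 n), fun h => ?_⟩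
    obtain ⟨S, hS, hSU⟩ := hU.2 h.1
    obtain ⟨R, hR, hRV⟩ := hV.2 h.2
    exact ⟨S ∩ R, inter_mem hS hR, fun n hn x => ⟨hSU n hn.1 x, hRV n hn.2 x⟩⟩
  isOpen_sUnion 𝒰 h := by
    refine ⟨fun n => ?_, fun hn => ?_⟩
    · have : {x : X n | FilterSum.pt n x ∈ ⋃₀ 𝒰}
          = ⋃ U ∈ 𝒰, {x : X n | FilterSum.pt n x ∈ U} := by
        ext x; simp only [mem_ofPred_eq, mem_sUnion, mem_iUnion, exists_prop]
      rw [this]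
      exact isOpen_biUnion fun U hU => (h U hU).1 n
    · obtain ⟨U, hU, hmem⟩ := hn
      obtain ⟨S, hS, hSU⟩ := (h U hU).2 hmem
      exact ⟨S, hS, fun n hn x => ⟨U, hU, hSU n hn x⟩⟩

/-- The spaces `T_α`. `T_0` is empty, `T_{α+1}` is `({n} × T_α)_n ∪_F {∞}` (so `T_1` is a single
point), and for a limit `α`, `T_α` is the topological sum of the `T_β` with `β < α`. -/
noncomputable def T (F : Filter ℕ) (α : Ordinal.{0}) : TopCat.{1} :=
  Ordinal.limitRecOn α
    (TopCat.of PEmpty)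
    (fun _ Tα => TopCat.of (FilterSum F fun _ => Tα))
    (fun α _ Tlt => TopCat.of (Σ β : Set.Iio α, Tlt β.1 β.2))

/-- The iterated Cantor-Bendixson derivatives `X^α`: `X^0 = X`, `X^{α+1}` is the set of
non-isolated points of `X^α`, and at limits one takes intersections. -/
noncomputable def derivative (X : Type*) [TopologicalSpace X] (α : Ordinal.{0}) : Set X :=
  Ordinal.limitRecOn α
    univ
    (fun _ D => {x | x ∈ D ∧ AccPt x (𝓟 D)})
    (fun α _ Dlt => ⋂ β : Set.Iio α, Dlt β.1 β.2)

/-- `X` is scattered of Cantor-Bendixson rank `α`: `α` is the least ordinal with `X^α = ∅`. -/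
def ScatteredOfRank (X : Type*) [TopologicalSpace X] (α : Ordinal.{0}) : Prop :=
  IsLeast {γ : Ordinal.{0} | derivative X γ = ∅} α

/-- An `α`-Toronto space: scattered of rank `α` and homeomorphic to each of its subspaces of
rank `α`. -/
def IsToronto (X : Type*) [TopologicalSpace X] (α : Ordinal.{0}) : Prop :=
  ScatteredOfRank X α ∧ ∀ S : Set X, ScatteredOfRank S α → Nonempty (X ≃ₜ S)

end TorontoSpaces

namespace TorontoSpaces

universe u v w

/-! The heart is `isMultiple_subspace`, an induction on `α` classifying all subspaces of `T_α`.
Since `T_γ` and its nonempty multiples have rank `γ`, the rank then decides which case occurs, and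
the theorem follows.

Two mechanisms drive the induction. By absorption (`absorbs`), `T_γ` swallows countably many `T_β`
with `β < γ`, so a countable sum of `T_β`'s depends only on the supremum of the indices and, if that
is attained, on how often (`isMultiple_sigma`).

The hard case is a subspace of `T_{α+1}` containing `∞`: multiples of `T_{β n}` glued along `F`. Let
`γ` be the limsup of `β` along `F`. Condition `(*)` gives a positive `A` on each infinite subset of
which `β` takes the value `γ` infinitely often or is cofinal in the limit `γ`
(`exists_positive_of_limsup`). Homogeneity and `F ≅ F × ω` present `F` as its own pullback along a
map whose fibres all meet `A` infinitely often (`Homogeneous.exists_self_map`). Grouping along the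
fibres turns every block into `ω` copies of `T_γ`, and `F × ω ≅ F` yields `T_{γ+1}`. -/

theorem _root_.Nonempty.homeo_trans {X Y Z : Type*} [TopologicalSpace X] [TopologicalSpace Y]
    [TopologicalSpace Z] (h : Nonempty (X ≃ₜ Y)) (h' : Nonempty (Y ≃ₜ Z)) :
    Nonempty (X ≃ₜ Z) :=
  ⟨h.some.trans h'.some⟩

theorem _root_.Nonempty.homeo_symm {X Y : Type*} [TopologicalSpace X] [TopologicalSpace Y]
    (h : Nonempty (X ≃ₜ Y)) : Nonempty (Y ≃ₜ X) :=
  ⟨h.some.symm⟩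

/-! ### Gluing spaces at a point along a filter -/

/-- The space `(X_i)_i ∪_G {∞}` for a filter `G` on an arbitrary index type. -/
inductive GSum {ι : Type v} (G : Filter ι) (X : ι → Type u) : Type max u v
  | infty : GSum G X
  | pt (i : ι) (x : X i) : GSum G X

namespace GSum

variable {ι : Type v} {κ : Type w} {G : Filter ι} {X : ι → Type u} [∀ i, TopologicalSpace (X i)]

instance : TopologicalSpace (GSum G X) where
  IsOpen U := (∀ i, IsOpen {x : X i | pt i x ∈ U}) ∧
    (infty ∈ U → ∃ S ∈ G, ∀ i ∈ S, ∀ x : X i, pt i x ∈ U)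
  isOpen_univ := ⟨fun _ => isOpen_univ, fun _ => ⟨univ, univ_mem, fun _ _ _ => mem_univ _⟩⟩
  isOpen_inter U V hU hV := by
    refine ⟨fun n => (hU.1 n).inter (hV.1 n), fun h => ?_⟩
    obtain ⟨S, hS, hSU⟩ := hU.2 h.1
    obtain ⟨R, hR, hRV⟩ := hV.2 h.2
    exact ⟨S ∩ R, inter_mem hS hR, fun n hn x => ⟨hSU n hn.1 x, hRV n hn.2 x⟩⟩
  isOpen_sUnion 𝒰 h := by
    refine ⟨fun n => ?_, fun hn => ?_⟩
    · have : {x : X n | pt n x ∈ ⋃₀ 𝒰} = ⋃ U ∈ 𝒰, {x : X n | pt n x ∈ U} := by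
        ext x; simp only [mem_ofPred_eq, mem_sUnion, mem_iUnion, exists_prop]
      rw [this]
      exact isOpen_biUnion fun U hU => (h U hU).1 n
    · obtain ⟨U, hU, hmem⟩ := hn
      obtain ⟨S, hS, hSU⟩ := (h U hU).2 hmem
      exact ⟨S, hS, fun n hn x => ⟨U, hU, hSU n hn x⟩⟩

theorem isOpen_iff {U : Set (GSum G X)} : IsOpen U ↔ (∀ i, IsOpen {x : X i | pt i x ∈ U}) ∧
    (infty ∈ U → ∃ S ∈ G, ∀ i ∈ S, ∀ x : X i, pt i x ∈ U) := Iff.rfl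

theorem isOpenEmbedding_pt (i : ι) : IsOpenEmbedding (pt i : X i → GSum G X) := by
  refine .of_continuous_injective_isOpenMap ?_ ?_ ?_
  · exact continuous_def.2 fun U hU => (isOpen_iff.1 hU).1 i
  · intro x y h
    simpa using h
  · intro V hV
    refine isOpen_iff.2 ⟨fun j => ?_, fun h => by simp at h⟩
    by_cases hj : j = i
    · subst hj
      simpa using hV
    · convert isOpen_empty using 1
      ext x
      simp only [mem_ofPred_eq, mem_image, mem_empty_iff_false, iff_false, not_exists, not_and]
      rintro y - h
      simp only [pt.injEq] at h
      exact hj h.1.symm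

theorem continuous_of {Z : Type*} [TopologicalSpace Z] {f : GSum G X → Z}
    (h : ∀ i, Continuous fun x => f (pt i x))
    (h' : ∀ U, IsOpen U → f infty ∈ U → ∃ S ∈ G, ∀ i ∈ S, ∀ x : X i, f (pt i x) ∈ U) :
    Continuous f :=
  continuous_def.2 fun U hU => isOpen_iff.2 ⟨fun i => hU.preimage (h i), h' U hU⟩

theorem nonempty_congr {Y : ι → Type*} [∀ i, TopologicalSpace (Y i)]
    (h : ∀ i, Nonempty (X i ≃ₜ Y i)) : Nonempty (GSum G X ≃ₜ GSum G Y) := by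
  have e := fun i => (h i).some
  refine ⟨⟨⟨fun | infty => infty | pt i x => pt i (e i x),
    fun | infty => infty | pt i x => pt i ((e i).symm x), ?_, ?_⟩, ?_, ?_⟩⟩
  · rintro (_ | _) <;> simp
  · rintro (_ | _) <;> simp
  · refine continuous_of (fun i => (isOpenEmbedding_pt i).continuous.comp (e i).continuous) ?_
    intro U hU hm
    obtain ⟨S, hS, h⟩ := (isOpen_iff.1 hU).2 hm
    exact ⟨S, hS, fun i hi x => h i hi _⟩
  · refine continuous_of (fun i => (isOpenEmbedding_pt i).continuous.comp (e i).symm.continuous) ?_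
    intro U hU hm
    obtain ⟨S, hS, h⟩ := (isOpen_iff.1 hU).2 hm
    exact ⟨S, hS, fun i hi x => h i hi _⟩

/-- Points may be grouped along a map of index sets. -/
theorem nonempty_group (φ : ι → κ) (H : Filter κ) (hG : comap φ H = G) :
    Nonempty (GSum G X ≃ₜ GSum H fun k => Σ i : {i // φ i = k}, X i) := by
  refine ⟨⟨⟨fun | infty => infty | pt i x => pt (φ i) ⟨⟨i, rfl⟩, x⟩,
    fun | infty => infty | pt _ p => pt p.1.1 p.2, ?_, ?_⟩, ?_, ?_⟩⟩
  · rintro (_ | _) <;> simp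
  · rintro (_ | ⟨_, ⟨⟨i, rfl⟩, x⟩⟩) <;> simp
  · refine continuous_of (fun i => (isOpenEmbedding_pt (φ i)).continuous.comp
      (continuous_sigmaMk (σ := fun j : {j // φ j = φ i} => X j) (i := ⟨i, rfl⟩))) ?_
    intro U hU hm
    obtain ⟨S, hS, h⟩ := (isOpen_iff.1 hU).2 hm
    exact ⟨φ ⁻¹' S, hG ▸ preimage_mem_comap hS, fun i hi x => h _ hi _⟩
  · refine continuous_of (fun k => continuous_sigma fun i => (isOpenEmbedding_pt i.1).continuous) ?_
    intro U hU hm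
    obtain ⟨S, hS, h⟩ := (isOpen_iff.1 hU).2 hm
    obtain ⟨R, hR, hRS⟩ := mem_comap.1 (hG ▸ hS)
    refine ⟨R, hR, ?_⟩
    rintro _ hi ⟨⟨i, rfl⟩, x⟩
    exact h i (hRS hi) x

theorem nonempty_reindex (e : κ ≃ ι) (H : Filter κ) (hG : map e H = G) :
    Nonempty (GSum H (fun k => X (e k)) ≃ₜ GSum G X) := by
  refine ⟨⟨⟨fun | infty => infty | pt k x => pt (e k) x,
    fun | infty => infty | pt i x => pt (e.symm i) (cast (by simp) x), ?_, ?_⟩, ?_, ?_⟩⟩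
  · rintro (_ | _) <;> simp
  · rintro (_ | ⟨i, x⟩)
    · simp
    · obtain ⟨k, rfl⟩ := e.surjective i
      simp
  · refine continuous_of (fun k => (isOpenEmbedding_pt (e k)).continuous) ?_
    intro U hU hm
    obtain ⟨S, hS, h⟩ := (isOpen_iff.1 hU).2 hm
    exact ⟨e ⁻¹' S, by subst hG; exact hS, fun i hi x => h _ hi _⟩
  · refine continuous_of (fun i => ?_) ?_
    · obtain ⟨k, rfl⟩ := e.surjective i
      convert (isOpenEmbedding_pt (X := fun k => X (e k)) (G := H) k).continuous using 2 with x
      simp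
    · intro U hU hm
      obtain ⟨S, hS, h⟩ := (isOpen_iff.1 hU).2 hm
      exact ⟨e '' S, by subst hG; exact image_mem_map hS, fun i hi x => h _ (by
        obtain ⟨k, hk, rfl⟩ := hi
        simpa using hk) _⟩

/-- The summands whose indices avoid a member of the filter split off. -/
theorem nonempty_split (A : Set ι) (hA : A ∈ G) : Nonempty (GSum G X ≃ₜ
    (Σ i : {i // i ∉ A}, X i) ⊕ GSum (comap (Subtype.val : A → ι) G) fun i : A => X i) := by
  classical
  refine ⟨⟨⟨fun | infty => .inr infty
                 | pt i x => if h : i ∈ A then .inr (pt ⟨i, h⟩ x) else .inl ⟨⟨i, h⟩, x⟩,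
    Sum.elim (fun p => pt p.1.1 p.2) (fun | infty => infty | pt i x => pt i.1 x), ?_, ?_⟩, ?_, ?_⟩⟩
  · rintro (_ | ⟨i, x⟩)
    · simp
    · by_cases h : i ∈ A <;> simp [h]
  · rintro (⟨⟨i, hi⟩, x⟩ | (_ | ⟨⟨i, hi⟩, x⟩))
    · simp [hi]
    · simp
    · simp [hi]
  · refine continuous_of (fun i => ?_) ?_
    · by_cases h : i ∈ A
      · simp only [h, dite_true]
        exact continuous_inr.comp (isOpenEmbedding_pt (X := fun i : A => X i) ⟨i, h⟩).continuous
      · simp only [h, dite_false]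
        exact continuous_inl.comp
          (continuous_sigmaMk (σ := fun j : {j // j ∉ A} => X j) (i := ⟨i, h⟩))
    · intro U hU hm
      obtain ⟨S, hS, h⟩ := (isOpen_iff.1 (hU.preimage continuous_inr)).2 hm
      obtain ⟨R, hR, hRS⟩ := mem_comap.1 hS
      refine ⟨R ∩ A, inter_mem hR hA, fun i hi x => ?_⟩
      simp only [hi.2, dite_true]
      exact h ⟨i, hi.2⟩ (hRS hi.1) x
  · refine Continuous.sumElim
      (continuous_sigma fun i => (isOpenEmbedding_pt i.1).continuous) ?_
    refine continuous_of (fun i => (isOpenEmbedding_pt i.1).continuous) ?_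
    intro U hU hm
    obtain ⟨S, hS, h⟩ := (isOpen_iff.1 hU).2 hm
    exact ⟨_, preimage_mem_comap hS, fun i hi x => h _ hi _⟩

/-- Indices with empty trace are kept, so the same filter `G` serves for the subspace. -/
theorem nonempty_subspace (S : Set (GSum G X)) (hS : infty ∈ S) :
    Nonempty (S ≃ₜ GSum G fun i => {x : X i | pt i x ∈ S}) := by
  refine ⟨Homeomorph.symm ⟨⟨fun | infty => ⟨infty, hS⟩ | pt i x => ⟨pt i x, x.2⟩,
    fun | ⟨infty, _⟩ => infty | ⟨pt i x, h⟩ => pt i ⟨x, h⟩, ?_, ?_⟩, ?_, ?_⟩⟩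
  · rintro (_ | _) <;> rfl
  · rintro ⟨(_ | _), h⟩ <;> rfl
  · refine continuous_of (fun i => Continuous.subtype_mk
      ((isOpenEmbedding_pt i).continuous.comp continuous_subtype_val) _) ?_
    rintro _ ⟨U, hU, rfl⟩ hm
    obtain ⟨S, hS, h⟩ := (isOpen_iff.1 hU).2 hm
    exact ⟨S, hS, fun i hi x => h i hi _⟩
  · refine continuous_def.2 fun U hU => ?_
    obtain ⟨hU1, hU2⟩ := isOpen_iff.1 hU
    choose V hV hVU using hU1
    by_cases hm : infty ∈ U
    · obtain ⟨R, hR, hRU⟩ := hU2 hm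
      -- The open extension of `U` takes whole summands over `R` and `V i` elsewhere; the
      -- implication holds vacuously at `∞`.
      refine ⟨{z | ∀ i x, z = pt i x → i ∈ R ∨ x ∈ V i}, isOpen_iff.2 ⟨fun i => ?_, fun _ =>
        ⟨R, hR, fun i hi x j y h => ?_⟩⟩, ?_⟩
      · by_cases hi : i ∈ R
        · convert isOpen_univ using 1
          ext x
          simp only [mem_ofPred_eq, mem_univ, iff_true]
          rintro j y h
          cases h
          exact .inl hi
        · convert hV i using 1
          ext x
          simp only [mem_ofPred_eq]
          constructor
          · intro h
            simpa [hi] using h i x rfl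
          · rintro h j y h'
            cases h'
            exact .inr h
      · cases h
        exact .inl hi
      · ext ⟨(_ | ⟨i, x⟩), hx⟩
        · simpa using hm
        · have := Set.ext_iff.1 (hVU i) ⟨x, hx⟩
          change x ∈ V i ↔ pt i ⟨x, hx⟩ ∈ U at this
          simp only [mem_preimage, mem_ofPred_eq]
          refine Iff.trans ?_ this
          constructor
          · intro h
            rcases h i x rfl with h | h
            · exact this.2 (hRU i h ⟨x, hx⟩)
            · exact h
          · rintro h j y h'
            cases h'
            exact .inr h
    · refine ⟨{z | ∃ i, ∃ x ∈ V i, z = pt i x}, isOpen_iff.2 ⟨fun i => ?_, fun h => ?_⟩, ?_⟩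
      · convert hV i using 1
        ext x
        simp only [mem_ofPred_eq]
        constructor
        · rintro ⟨j, y, hy, h⟩
          cases h
          exact hy
        · exact fun h => ⟨i, x, h, rfl⟩
      · obtain ⟨i, x, -, h⟩ := h
        cases h
      · ext ⟨(_ | ⟨i, x⟩), hx⟩
        · simpa using hm
        · have := Set.ext_iff.1 (hVU i) ⟨x, hx⟩
          change x ∈ V i ↔ pt i ⟨x, hx⟩ ∈ U at this
          simp only [mem_preimage, mem_ofPred_eq]
          refine Iff.trans ?_ this
          constructor
          · rintro ⟨j, y, hy, h⟩
            cases h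
            exact hy
          · exact fun h => ⟨i, x, h, rfl⟩

end GSum

/-! ### Calculus of topological sums -/

/-- A disjoint cover by open subspaces is a topological sum. -/
theorem nonempty_sigma_of_isOpenEmbedding {ι : Type*} {Y : ι → Type*} {Z : Type*}
    [∀ i, TopologicalSpace (Y i)] [TopologicalSpace Z] (f : ∀ i, Y i → Z)
    (hf : ∀ i, IsOpenEmbedding (f i)) (hd : ∀ i j x y, f i x = f j y → i = j)
    (hc : ∀ z, ∃ i x, f i x = z) : Nonempty (Z ≃ₜ Σ i, Y i) := by
  have hb : Function.Bijective fun p : Σ i, Y i => f p.1 p.2 := by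
    refine ⟨?_, fun z => ?_⟩
    · rintro ⟨i, x⟩ ⟨j, y⟩ h
      obtain rfl := hd i j x y h
      obtain rfl := (hf i).injective h
      rfl
    · obtain ⟨i, x, h⟩ := hc z
      exact ⟨⟨i, x⟩, h⟩
  exact ⟨((Equiv.ofBijective _ hb).toHomeomorphOfContinuousOpen
    (continuous_sigma fun i => (hf i).continuous) (isOpenMap_sigma.2 fun i => (hf i).isOpenMap)).symm⟩

theorem GSum.nonempty_subspace_of_notMem {ι : Type*} {G : Filter ι} {X : ι → Type*}
    [∀ i, TopologicalSpace (X i)] (S : Set (GSum G X)) (hS : infty ∉ S) :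
    Nonempty (S ≃ₜ Σ i, {x : X i | pt i x ∈ S}) := by
  refine nonempty_sigma_of_isOpenEmbedding (fun i x => ⟨pt i x, x.2⟩)
    (fun i => (isOpenEmbedding_pt i).restrictPreimage S) ?_ ?_
  · intro i j x y h
    simp only [Subtype.mk.injEq, pt.injEq] at h
    exact h.1
  · rintro ⟨(_ | ⟨i, x⟩), h⟩
    · exact absurd h hS
    · exact ⟨i, ⟨x, h⟩, rfl⟩

theorem nonempty_sigma_subspace {ι : Type*} {X : ι → Type*}
    [∀ i, TopologicalSpace (X i)] (S : Set (Σ i, X i)) :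
    Nonempty (S ≃ₜ Σ i, {x : X i | (⟨i, x⟩ : Σ i, X i) ∈ S}) := by
  refine nonempty_sigma_of_isOpenEmbedding (fun i x => ⟨⟨i, x⟩, x.2⟩)
    (fun i => (IsOpenEmbedding.sigmaMk (i := i)).restrictPreimage S) ?_ ?_
  · intro i j x y h
    simp only [Subtype.mk.injEq, Sigma.mk.injEq] at h
    exact h.1
  · rintro ⟨⟨i, x⟩, h⟩
    exact ⟨i, ⟨x, h⟩, rfl⟩

theorem nonempty_sigma_congr {ι : Type*} {X Y : ι → Type*} [∀ i, TopologicalSpace (X i)]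
    [∀ i, TopologicalSpace (Y i)] (h : ∀ i, Nonempty (X i ≃ₜ Y i)) :
    Nonempty ((Σ i, X i) ≃ₜ Σ i, Y i) := by
  have e := fun i => (h i).some
  refine nonempty_sigma_of_isOpenEmbedding (fun i y => ⟨i, (e i).symm y⟩)
    (fun i => IsOpenEmbedding.sigmaMk.comp (e i).symm.isOpenEmbedding) ?_ ?_
  · intro i j x y h
    simp only [Sigma.mk.injEq] at h
    exact h.1
  · rintro ⟨i, x⟩
    exact ⟨i, e i x, by simp⟩

theorem nonempty_sigma_reindex {ι κ : Type*} {X : ι → Type*} [∀ i, TopologicalSpace (X i)]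
    (e : κ ≃ ι) : Nonempty ((Σ i, X i) ≃ₜ Σ k, X (e k)) := by
  refine nonempty_sigma_of_isOpenEmbedding (fun k x => ⟨e k, x⟩)
    (fun k => IsOpenEmbedding.sigmaMk) ?_ ?_
  · intro i j x y h
    simp only [Sigma.mk.injEq] at h
    exact e.injective h.1
  · rintro ⟨i, x⟩
    obtain ⟨k, rfl⟩ := e.surjective i
    exact ⟨k, x, rfl⟩

theorem nonempty_sigma_group {ι κ : Type*} {X : ι → Type*} [∀ i, TopologicalSpace (X i)]
    (φ : ι → κ) : Nonempty ((Σ i, X i) ≃ₜ Σ k, Σ i : {i // φ i = k}, X i) := by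
  refine ⟨Homeomorph.symm (nonempty_sigma_of_isOpenEmbedding
    (fun i x => ⟨φ i, ⟨i, rfl⟩, x⟩) (fun i => ?_) ?_ ?_).some⟩
  · exact (IsOpenEmbedding.sigmaMk (σ := fun k => Σ i : {i // φ i = k}, X i)).comp
      (IsOpenEmbedding.sigmaMk (σ := fun j : {j // φ j = φ i} => X j) (i := ⟨i, rfl⟩))
  · intro i j x y h
    exact congrArg (fun p : Σ k, Σ i : {i // φ i = k}, X i => p.2.1.1) h
  · rintro ⟨_, ⟨i, rfl⟩, x⟩
    exact ⟨i, x, rfl⟩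

theorem nonempty_sigma_sum {ι κ : Type*} {X : ι ⊕ κ → Type*} [∀ i, TopologicalSpace (X i)] :
    Nonempty ((Σ i, X i) ≃ₜ (Σ i, X (.inl i)) ⊕ (Σ k, X (.inr k))) := by
  refine ⟨⟨⟨fun | ⟨.inl i, x⟩ => .inl ⟨i, x⟩ | ⟨.inr k, x⟩ => .inr ⟨k, x⟩,
    Sum.elim (fun p => ⟨.inl p.1, p.2⟩) (fun p => ⟨.inr p.1, p.2⟩), ?_, ?_⟩, ?_, ?_⟩⟩
  · rintro ⟨i | k, x⟩ <;> rfl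
  · rintro (⟨i, x⟩ | ⟨k, x⟩) <;> rfl
  · refine continuous_sigma ?_
    rintro (i | k)
    · exact continuous_inl.comp (continuous_sigmaMk (σ := fun i => X (.inl i)))
    · exact continuous_inr.comp (continuous_sigmaMk (σ := fun i => X (.inr i)))
  · exact Continuous.sumElim (continuous_sigma fun i => continuous_sigmaMk)
      (continuous_sigma fun i => continuous_sigmaMk)

/-- Iterated sums are sums over the disjoint union of the index sets. -/
theorem nonempty_sigma_assoc {ι : Type*} {κ : ι → Type*} {X : ∀ i, κ i → Type*}
    [∀ i k, TopologicalSpace (X i k)] :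
    Nonempty ((Σ i, Σ k, X i k) ≃ₜ Σ p : (Σ i, κ i), X p.1 p.2) := by
  refine nonempty_sigma_of_isOpenEmbedding (fun p x => ⟨p.1, p.2, x⟩) (fun p => ?_) ?_ ?_
  · exact (IsOpenEmbedding.sigmaMk (σ := fun i => Σ k, X i k)).comp
      (IsOpenEmbedding.sigmaMk (σ := fun k => X p.1 k))
  · intro p q x y h
    exact congrArg (fun z : Σ i, Σ k, X i k => (⟨z.1, z.2.1⟩ : Σ i, κ i)) h
  · rintro ⟨i, k, x⟩
    exact ⟨⟨i, k⟩, x, rfl⟩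

theorem nonempty_sigma_distrib {ι : Type*} {X Y : ι → Type*} [∀ i, TopologicalSpace (X i)]
    [∀ i, TopologicalSpace (Y i)] :
    Nonempty ((Σ i, X i) ⊕ (Σ i, Y i) ≃ₜ Σ i, X i ⊕ Y i) := by
  refine ⟨⟨⟨Sum.elim (fun p => ⟨p.1, .inl p.2⟩) (fun p => ⟨p.1, .inr p.2⟩),
    fun p => p.2.elim (fun x => .inl ⟨p.1, x⟩) (fun x => .inr ⟨p.1, x⟩), ?_, ?_⟩, ?_, ?_⟩⟩
  · rintro (⟨i, x⟩ | ⟨i, x⟩) <;> rfl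
  · rintro ⟨i, x | x⟩ <;> rfl
  · exact Continuous.sumElim
      (continuous_sigma fun i => (continuous_sigmaMk (σ := fun i => X i ⊕ Y i) (i := i)).comp
        (continuous_inl (X := X i) (Y := Y i)))
      (continuous_sigma fun i => (continuous_sigmaMk (σ := fun i => X i ⊕ Y i) (i := i)).comp
        (continuous_inr (X := X i) (Y := Y i)))
  · exact continuous_sigma fun i => Continuous.sumElim
      (continuous_inl.comp continuous_sigmaMk) (continuous_inr.comp continuous_sigmaMk)

/-- A sum splits according to a predicate on the index set. -/
theorem nonempty_sigma_compl {ι : Type*} {X : ι → Type*} [∀ i, TopologicalSpace (X i)]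
    (p : ι → Prop) :
    Nonempty ((Σ i, X i) ≃ₜ (Σ i : {i // p i}, X i) ⊕ Σ i : {i // ¬ p i}, X i) := by
  classical
  exact (nonempty_sigma_reindex (Equiv.sumCompl p)).homeo_trans
    (nonempty_sigma_sum (X := fun k => X (Equiv.sumCompl p k)))

theorem nonempty_sigma_unique {ι : Type*} [Unique ι] {X : ι → Type*}
    [∀ i, TopologicalSpace (X i)] : Nonempty ((Σ i, X i) ≃ₜ X default) := by
  refine ⟨(Homeomorph.symm ((Equiv.ofBijective _ ⟨sigma_mk_injective, ?_⟩ :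
    X default ≃ Σ i, X i).toHomeomorphOfContinuousOpen continuous_sigmaMk isOpenMap_sigmaMk))⟩
  rintro ⟨i, x⟩
  obtain rfl := Unique.eq_default i
  exact ⟨x, rfl⟩

theorem nonempty_sum_congr {X X' Y Y' : Type*} [TopologicalSpace X] [TopologicalSpace X']
    [TopologicalSpace Y] [TopologicalSpace Y'] (h : Nonempty (X ≃ₜ X')) (h' : Nonempty (Y ≃ₜ Y')) :
    Nonempty (X ⊕ Y ≃ₜ X' ⊕ Y') :=
  ⟨h.some.sumCongr h'.some⟩

/-! ### Homogeneous filters -/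

section Filters

variable {F : Filter ℕ}

theorem Positive.of_mem {A : Type*} {G : Filter A} [G.NeBot] {S : Set A} (h : S ∈ G) :
    Positive G S :=
  fun _ hR => nonempty_of_mem (inter_mem h hR)

theorem compl_mem_of_not_positive {A : Type*} {G : Filter A} {S : Set A} (h : ¬ Positive G S) :
    Sᶜ ∈ G := by
  simp only [Positive, not_forall, not_nonempty_iff_eq_empty] at h
  obtain ⟨R, hR, h⟩ := h
  exact mem_of_superset hR fun x hx hS => (h ▸ ⟨hS, hx⟩ : x ∈ (∅ : Set A))

/-- Positive sets of a homogeneous filter on `ℕ` are infinite, so its finite sets are null. -/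
theorem Homogeneous.compl_finite_mem (hF : Homogeneous F) {S : Set ℕ} (hS : S.Finite) :
    Sᶜ ∈ F := by
  refine compl_mem_of_not_positive fun h => ?_
  obtain ⟨e, -⟩ := hF S h
  have := hS.to_subtype
  exact (Finite.of_equiv S e : Finite ℕ).not_infinite inferInstance

theorem comap_equiv_of_map_eq {A B : Type*} {G : Filter A} {H : Filter B} {e : A ≃ B}
    (h : map e G = H) : comap e H = G := by
  rw [← h, comap_map e.injective]

/-- A homogeneous filter is the pullback of its restriction to any positive set `A`, along some
retraction onto `A`. -/
theorem Homogeneous.exists_retraction (hF : Homogeneous F) {A : Set ℕ} (hA : Positive F A) :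
    ∃ ρ : ℕ → A, (∀ a : A, ρ a = a) ∧ comap ρ (restrict F A) = F := by
  classical
  -- If `Aᶜ` is positive, both restrictions are isomorphic to `F`. Otherwise the trace on `Aᶜ` is
  -- improper, and a constant map works because singletons are null.
  have key : ∃ ε : (Aᶜ : Set ℕ) → A,
      comap ε (restrict F A) = comap (Subtype.val : (Aᶜ : Set ℕ) → ℕ) F := by
    by_cases hQ : Positive F Aᶜ
    · obtain ⟨e, he⟩ := hF _ hQ
      obtain ⟨e', he'⟩ := hF _ hA
      refine ⟨fun x => e'.symm (e x), ?_⟩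
      rw [← comap_equiv_of_map_eq he', comap_comap]
      have : (e' ∘ fun x => e'.symm (e x)) = e := by ext; simp
      rw [this, comap_equiv_of_map_eq he]
      rfl
    · obtain ⟨p, hp, -⟩ := hA univ univ_mem
      refine ⟨fun _ => ⟨p, hp⟩, ?_⟩
      trans ⊥
      · rw [← empty_mem_iff_bot]
        refine ⟨_, preimage_mem_comap (hF.compl_finite_mem (finite_singleton p)), ?_⟩
        intro x hx
        exact hx rfl
      · symm
        rw [← empty_mem_iff_bot]
        exact ⟨_, compl_mem_of_not_positive hQ, fun x hx => hx x.2⟩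
  obtain ⟨ε, hε⟩ := key
  let ρ : ℕ → A := fun n => if h : n ∈ A then ⟨n, h⟩ else ε ⟨n, h⟩
  have hρA : ∀ n (h : n ∈ A), ρ n = ⟨n, h⟩ := fun n h => dif_pos h
  have hρQ : ∀ n (h : n ∉ A), ρ n = ε ⟨n, h⟩ := fun n h => dif_neg h
  refine ⟨ρ, fun a => hρA a a.2, le_antisymm (fun S hS => ?_) ?_⟩
  · have h1 : Subtype.val ⁻¹' S ∈ comap ε (restrict F A) := hε ▸ preimage_mem_comap hS
    obtain ⟨R, hR, hRS⟩ := h1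
    refine ⟨R ∩ Subtype.val ⁻¹' S, inter_mem hR (preimage_mem_comap hS), fun n hn => ?_⟩
    by_cases h : n ∈ A
    · have := hn.2
      rwa [mem_preimage, hρA n h] at this
    · have := hn.1
      rw [hρQ n h] at this
      exact hRS (a := ⟨n, h⟩) this
  · rintro S ⟨R, hR, hRS⟩
    obtain ⟨U, hU, hUR⟩ := hR
    have h1 : ε ⁻¹' R ∈ comap (Subtype.val : (Aᶜ : Set ℕ) → ℕ) F :=
      hε ▸ preimage_mem_comap ⟨U, hU, hUR⟩
    obtain ⟨V, hV, hVR⟩ := h1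
    filter_upwards [hU, hV] with n hnU hnV
    refine hRS ?_
    by_cases h : n ∈ A
    · rw [mem_preimage, hρA n h]
      exact hUR (a := ⟨n, h⟩) hnU
    · rw [mem_preimage, hρQ n h]
      exact hVR (a := ⟨n, h⟩) hnV

/-- `F` is a pullback of itself along a map whose fibres meet a given positive set infinitely
often. -/
theorem Homogeneous.exists_self_map (hF : Homogeneous F) (hiso : FilterIso F (timesOmega F))
    {A : Set ℕ} (hA : Positive F A) :
    ∃ ψ : ℕ → ℕ, comap ψ F = F ∧ ∀ n, (A ∩ ψ ⁻¹' {n}).Infinite := by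
  obtain ⟨ρ, hρ, hρF⟩ := hF.exists_retraction hA
  obtain ⟨e, he⟩ := hF A hA
  obtain ⟨e', he'⟩ := hiso
  -- Retract onto `A`, identify `A` with `ω` and then with `ω × ω`, and project. Since `ρ` fixes
  -- `A`, the fibre over `n` contains the points of `A` corresponding to column `n`.
  refine ⟨fun n => (e' (e (ρ n))).1, ?_, fun n => ?_⟩
  · calc comap (fun n => (e' (e (ρ n))).1) F = comap ρ (comap e (comap e' (timesOmega F))) := by
          simp only [timesOmega, comap_comap]; rfl
      _ = F := by rw [comap_equiv_of_map_eq he', comap_equiv_of_map_eq he, hρF]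
  · refine infinite_of_injective_forall_mem (f := fun k : ℕ => (e.symm (e'.symm (n, k)) : ℕ))
      (fun k l h => ?_) fun k => ⟨Subtype.coe_prop _, ?_⟩
    · simpa using Subtype.ext h
    · simp [hρ]

/-- In `F × ω` a single column is infinite yet null. -/
theorem exists_mem_compl_infinite (hiso : FilterIso F (timesOmega F)) (hF : Homogeneous F) :
    ∃ A ∈ F, (Aᶜ).Infinite := by
  obtain ⟨e, he⟩ := hiso
  have h : {p : ℕ × ℕ | p.1 ≠ 0} ∈ timesOmega F :=
    preimage_mem_comap (hF.compl_finite_mem (finite_singleton 0))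
  rw [← he] at h
  refine ⟨_, h, infinite_of_injective_forall_mem (f := fun k : ℕ => e.symm (0, k))
      (fun k l h => by simpa using h) fun k => by simp⟩

end Filters

/-! ### The spaces `T_α`: absorption and countable sums -/

theorem nonempty_filterSum_homeo (F : Filter ℕ) (X : ℕ → Type*) [∀ n, TopologicalSpace (X n)] :
    Nonempty (FilterSum F X ≃ₜ GSum F X) := by
  refine ⟨⟨⟨fun | .infty => .infty | .pt n x => .pt n x,
    fun | .infty => .infty | .pt n x => .pt n x, ?_, ?_⟩, ?_, ?_⟩⟩
  · rintro (_ | _) <;> rfl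
  · rintro (_ | _) <;> rfl
  · exact continuous_def.2 fun U hU => hU
  · exact continuous_def.2 fun U hU => hU

theorem nonempty_homeo_of_eq {X Y : TopCat.{u}} (h : X = Y) : Nonempty (X ≃ₜ Y) := by
  subst h
  exact ⟨Homeomorph.refl _⟩

section T

variable (F : Filter ℕ)

instance isEmpty_T_zero : IsEmpty (T F 0) := by
  have h : T F 0 = TopCat.of PEmpty := Ordinal.limitRecOn_zero ..
  rw [h]
  exact inferInstanceAs (IsEmpty PEmpty)

theorem nonempty_T_succ (α : Ordinal.{0}) :
    Nonempty (T F (α + 1) ≃ₜ GSum F fun _ : ℕ => T F α) := by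
  have h : T F (α + 1) = TopCat.of (FilterSum F fun _ => T F α) := Ordinal.limitRecOn_add_one ..
  exact (nonempty_homeo_of_eq h).homeo_trans (nonempty_filterSum_homeo F fun _ => T F α)

theorem nonempty_T_limit {α : Ordinal.{0}} (h : Order.IsSuccLimit α) :
    Nonempty (T F α ≃ₜ Σ β : Iio α, T F β.1) := by
  have h : T F α = TopCat.of (Σ β : Iio α, T F β.1) := Ordinal.limitRecOn_limit (h := h) ..
  exact nonempty_homeo_of_eq h

/-- `T_γ` absorbs countable sums of spaces `T_β` with `β < γ`. -/
def Absorbs (γ : Ordinal.{0}) : Prop :=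
  ∀ (I : Type v) [Countable I] (β : I → Ordinal.{0}), (∀ i, β i < γ) →
    Nonempty (T F γ ⊕ (Σ i, T F (β i)) ≃ₜ T F γ)

variable {F}

theorem nonempty_sigma_const_T {I : Type u} {β : I → Ordinal.{0}} {γ : Ordinal.{0}}
    (h : ∀ i, β i = γ) : Nonempty ((Σ i, T F (β i)) ≃ₜ Σ _ : I, T F γ) :=
  nonempty_sigma_congr fun i => by rw [h i]; exact ⟨Homeomorph.refl _⟩

theorem nonempty_sigma_reindex_const {I : Type u} {J : Type v} (e : I ≃ J) (X : Type w)
    [TopologicalSpace X] : Nonempty ((Σ _ : I, X) ≃ₜ Σ _ : J, X) :=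
  (nonempty_sigma_reindex (X := fun _ => X) e).homeo_symm

/-- The map `g` sends each small summand to a larger one that swallows it; absorption is applied
over each fibre of `g`. -/
theorem nonempty_sum_absorb {I : Type v} {J : Type w} [Countable I] {β : I → Ordinal.{0}}
    {γ : J → Ordinal.{0}} (g : I → J) (hg : ∀ i, β i < γ (g i))
    (hγ : ∀ j, Absorbs.{v} F (γ j)) :
    Nonempty ((Σ j, T F (γ j)) ⊕ (Σ i, T F (β i)) ≃ₜ Σ j, T F (γ j)) := by
  refine (nonempty_sum_congr ⟨Homeomorph.refl _⟩ (nonempty_sigma_group g)).homeo_trans ?_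
  refine nonempty_sigma_distrib.homeo_trans (nonempty_sigma_congr fun j => ?_)
  exact hγ j {i // g i = j} (fun i => β i) fun i => (hg i).trans_eq (by rw [i.2])

theorem Absorbs.nonempty_sigma {I : Type v} [Countable I] {γ : Ordinal.{0}}
    (hγ : Absorbs.{v} F γ) {β : I → Ordinal.{0}} (h : ∀ i, β i ≤ γ) (h' : ∃ i, β i = γ) :
    Nonempty ((Σ i, T F (β i)) ≃ₜ Σ _ : {i // β i = γ}, T F γ) := by
  obtain ⟨i₀, h₀⟩ := h'
  refine (nonempty_sigma_compl fun i => β i = γ).homeo_trans ?_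
  refine Nonempty.homeo_trans ?_ (nonempty_sigma_const_T fun i : {i // β i = γ} => i.2)
  exact nonempty_sum_absorb (γ := fun i : {i // β i = γ} => β i) (fun _ => ⟨i₀, h₀⟩)
    (fun i => h₀.symm ▸ (h i).lt_of_ne i.2) (fun j => j.2.symm ▸ hγ)

/-- Splitting off the infinite complement of some `A ∈ F` frees `ω` copies of `T_δ`; homogeneity
identifies what remains over `A` with the original space. -/
theorem nonempty_T_succ_absorb (hF : F.NeBot) (hhom : Homogeneous F)
    (hiso : FilterIso F (timesOmega F)) (δ : Ordinal.{0}) :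
    Nonempty (T F (δ + 1) ≃ₜ T F (δ + 1) ⊕ Σ _ : ℕ, T F δ) := by
  obtain ⟨A, hA, hAc⟩ := exists_mem_compl_infinite hiso hhom
  have hinf : Infinite {n // n ∉ A} := hAc.to_subtype
  obtain ⟨e⟩ := nonempty_equiv_of_countable (α := {n // n ∉ A}) (β := ℕ)
  obtain ⟨e', he'⟩ := hhom A (.of_mem hA)
  refine (nonempty_T_succ F δ).homeo_trans ((GSum.nonempty_split A hA).homeo_trans ?_)
  refine Nonempty.homeo_trans ?_ ⟨Homeomorph.sumComm _ _⟩
  exact nonempty_sum_congr (nonempty_sigma_reindex_const e _)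
    ((GSum.nonempty_reindex (X := fun _ : ℕ => T F δ) e' _ he').homeo_trans
      (nonempty_T_succ F δ).homeo_symm)

theorem absorbs (hF : F.NeBot) (hhom : Homogeneous F)
    (hiso : FilterIso F (timesOmega F)) (γ : Ordinal.{0}) : Absorbs.{v} F γ := by
  induction γ using Ordinal.limitRecOn with
  | zero =>
    intro I _ β h
    have : IsEmpty I := ⟨fun i => not_lt_bot (h i)⟩
    exact ⟨Homeomorph.sumEmpty _ _⟩
  | add_one δ ih =>
    intro I _ β h
    have hS := nonempty_T_succ_absorb hF hhom hiso δ
    refine (nonempty_sum_congr hS ⟨Homeomorph.refl _⟩).homeo_trans ?_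
    refine Nonempty.homeo_trans ⟨Homeomorph.sumAssoc _ _ _⟩ ?_
    refine Nonempty.homeo_trans (nonempty_sum_congr ⟨Homeomorph.refl _⟩ ?_) hS.homeo_symm
    -- Pool the `ω` freed copies of `T_δ` with the summands to be absorbed. All indices are at most
    -- `δ`, which occurs infinitely often, so the pool is again `ω` copies of `T_δ`.
    let β' : ℕ ⊕ I → Ordinal.{0} := Sum.elim (fun _ => δ) β
    have hinf : Infinite {i // β' i = δ} :=
      Infinite.of_injective (fun n : ℕ => (⟨.inl n, rfl⟩ : {i // β' i = δ})) fun m n h =>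
        Sum.inl_injective (congrArg Subtype.val h)
    obtain ⟨e⟩ := nonempty_equiv_of_countable (α := {i // β' i = δ}) (β := ℕ)
    refine Nonempty.homeo_trans ?_ ((ih.nonempty_sigma (β := β') ?_ ⟨.inl 0, rfl⟩).homeo_trans
      (nonempty_sigma_reindex_const e _))
    · exact (nonempty_sigma_sum (X := fun i => T F (β' i))).homeo_symm
    · rintro (n | i)
      · exact le_rfl
      · exact Order.lt_add_one_iff.1 (h i)
  | limit γ hγ ih =>
    intro I _ β h
    have hL := nonempty_T_limit F hγ
    refine (nonempty_sum_congr hL ⟨Homeomorph.refl _⟩).homeo_trans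
      (Nonempty.homeo_trans ?_ hL.homeo_symm)
    exact nonempty_sum_absorb (γ := fun δ : Iio γ => δ.1)
      (fun i => ⟨β i + 1, hγ.add_one_lt (h i)⟩) (fun i => Order.lt_add_one_iff.2 le_rfl)
      (fun δ => ih δ δ.2)

theorem countable_Iio_of_lt {γ : Ordinal.{0}} (hγ : γ < Ordinal.omega 1) : Countable (Iio γ) := by
  rw [← Cardinal.mk_le_aleph0_iff, Cardinal.mk_Iio_ordinal, Cardinal.lift_le_aleph0,
    ← Order.lt_succ_iff, Cardinal.succ_aleph0]
  exact Cardinal.lt_omega_iff_card_lt.1 hγ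

/-- A sum over a family of ordinals that is cofinal in the limit `γ` is `T_γ`. -/
theorem nonempty_sigma_limit (hF : F.NeBot) (hhom : Homogeneous F)
    (hiso : FilterIso F (timesOmega F)) {γ : Ordinal.{0}} (hγ : Order.IsSuccLimit γ)
    (hγ1 : γ < Ordinal.omega 1) {I : Type v} [Countable I] {β : I → Ordinal.{0}}
    (h : ∀ i, β i < γ) (hc : ∀ δ < γ, ∃ i, δ < β i) :
    Nonempty ((Σ i, T F (β i)) ≃ₜ T F γ) := by
  have := countable_Iio_of_lt hγ1
  refine Nonempty.homeo_trans ?_ (nonempty_T_limit F hγ).homeo_symm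
  -- Both families are cofinal in `γ`, so each of the two sums absorbs the other.
  have h1 := nonempty_sum_absorb (F := F) (β := fun δ : Iio γ => δ.1) (γ := β)
    (fun δ => (hc δ δ.2).choose) (fun δ => (hc δ δ.2).choose_spec)
    (fun _ => absorbs hF hhom hiso _)
  have h2 := nonempty_sum_absorb (F := F) (β := β) (γ := fun δ : Iio γ => δ.1)
      (fun i => ⟨β i + 1, hγ.add_one_lt (h i)⟩) (fun i => Order.lt_add_one_iff.2 le_rfl)
    (fun _ => absorbs hF hhom hiso _)
  exact h1.homeo_symm.homeo_trans (Nonempty.homeo_trans ⟨Homeomorph.sumComm _ _⟩ h2)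

/-- A summand `T_γ` is itself a sum of smaller ones and can be expanded. In particular every
nonempty countable multiple of `T_γ`, `γ` a limit, is `T_γ`. -/
theorem nonempty_sigma_limit_of_le (hF : F.NeBot) (hhom : Homogeneous F)
    (hiso : FilterIso F (timesOmega F)) {γ : Ordinal.{0}} (hγ : Order.IsSuccLimit γ)
    (hγ1 : γ < Ordinal.omega 1) {I : Type v} [Countable I] {β : I → Ordinal.{0}}
    (h : ∀ i, β i ≤ γ) (hc : ∀ δ < γ, ∃ i, δ < β i) :
    Nonempty ((Σ i, T F (β i)) ≃ₜ T F γ) := by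
  classical
  have := countable_Iio_of_lt hγ1
  have key : ∀ i, ∃ (K : Type 1) (_ : Countable K) (b : K → Ordinal.{0}), (∀ k, b k < γ) ∧
      (∀ δ < γ, δ < β i → ∃ k, δ < b k) ∧ Nonempty (T F (β i) ≃ₜ Σ k, T F (b k)) := by
    intro i
    rcases (h i).eq_or_lt with hi | hi
    · refine ⟨Iio γ, this, Subtype.val, fun k => k.2, fun δ hδ _ => ?_, ?_⟩
      · exact ⟨⟨δ + 1, hγ.add_one_lt hδ⟩, Order.lt_add_one_iff.2 le_rfl⟩
      · rw [hi]
        exact nonempty_T_limit F hγ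
    · exact ⟨PUnit, inferInstance, fun _ => β i, fun _ => hi, fun δ _ h => ⟨⟨⟩, h⟩,
        (nonempty_sigma_unique (X := fun _ : PUnit => T F (β i))).homeo_symm⟩
  choose K hK b hb hbc hbT using key
  refine (nonempty_sigma_congr hbT).homeo_trans (nonempty_sigma_assoc.homeo_trans ?_)
  refine nonempty_sigma_limit hF hhom hiso hγ hγ1 (β := fun p : Σ i, K i => b p.1 p.2)
    (fun p => hb _ _) fun δ hδ => ?_
  obtain ⟨i, hi⟩ := hc δ hδ
  obtain ⟨k, hk⟩ := hbc i δ hδ hi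
  exact ⟨⟨i, k⟩, hk⟩

/-- Sums with summands `T_β`, `β ≤ γ`, in which `γ` is attained or approached infinitely often. -/
theorem nonempty_sigma_omega (hF : F.NeBot) (hhom : Homogeneous F)
    (hiso : FilterIso F (timesOmega F)) {γ : Ordinal.{0}}
    (hγ1 : γ < Ordinal.omega 1) {I : Type v} [Countable I] {β : I → Ordinal.{0}}
    (h : ∀ i, β i ≤ γ)
    (hc : {i | β i = γ}.Infinite ∨ Order.IsSuccLimit γ ∧ ∀ δ < γ, ∃ i, δ < β i) :
    Nonempty ((Σ i, T F (β i)) ≃ₜ Σ _ : ℕ, T F γ) := by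
  rcases hc with hc | ⟨hl, hc⟩
  · have hinf : Infinite {i // β i = γ} := hc.to_subtype
    obtain ⟨e⟩ := nonempty_equiv_of_countable (α := {i // β i = γ}) (β := ℕ)
    exact ((absorbs hF hhom hiso γ).nonempty_sigma h hc.nonempty).homeo_trans
      (nonempty_sigma_reindex_const e _)
  · refine (nonempty_sigma_limit_of_le hF hhom hiso hl hγ1 h hc).homeo_trans
      (Nonempty.homeo_symm (nonempty_sigma_limit_of_le hF hhom hiso hl hγ1 (fun _ => le_rfl)
        fun δ hδ => ⟨0, hδ⟩))

/-- `X` is homeomorphic to `T_α` or to a nonempty countable multiple of some `T_γ` with `γ < α`. -/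
def IsMultiple (F : Filter ℕ) (α : Ordinal.{0}) (X : Type*) [TopologicalSpace X] : Prop :=
  Nonempty (X ≃ₜ T F α) ∨ ∃ γ < α, ∃ κ : Type, Countable κ ∧ Nonempty κ ∧
    Nonempty (X ≃ₜ Σ _ : κ, T F γ)

theorem IsMultiple.congr {α : Ordinal.{0}} {X : Type*} {Y : Type*} [TopologicalSpace X]
    [TopologicalSpace Y] (h : Nonempty (X ≃ₜ Y)) (hY : IsMultiple F α Y) : IsMultiple F α X := by
  rcases hY with hY | ⟨γ, hγ, κ, h1, h2, h3⟩
  · exact .inl (h.homeo_trans hY)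
  · exact .inr ⟨γ, hγ, κ, h1, h2, h.homeo_trans h3⟩

/-- Let `γ` be the supremum of the indices. If attained, the summands below it are absorbed; if not,
`γ` is a limit, possibly `α`, and the sum is `T_γ`. -/
theorem isMultiple_sigma (hF : F.NeBot) (hhom : Homogeneous F)
    (hiso : FilterIso F (timesOmega F)) {α : Ordinal.{0}} (hα : α < Ordinal.omega 1)
    {I : Type v} [Countable I] {β : I → Ordinal.{0}} (h : ∀ i, β i < α) :
    IsMultiple F α (Σ i, T F (β i)) := by
  by_cases hI : IsEmpty I
  -- The empty space counts as one copy of the empty `T_0`.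
  · rcases eq_zero_or_pos α with rfl | h0
    · exact .inl ⟨Homeomorph.empty⟩
    · have : IsEmpty (Σ _ : Unit, T F 0) := ⟨fun p => isEmptyElim p.2⟩
      exact .inr ⟨0, h0, Unit, inferInstance, inferInstance, ⟨Homeomorph.empty⟩⟩
  rw [not_isEmpty_iff] at hI
  let U : Set Ordinal.{0} := {γ | ∀ i, β i ≤ γ}
  have hU : U.Nonempty := ⟨α, fun i => (h i).le⟩
  set γ := sInf U with hγ
  have hγU : ∀ i, β i ≤ γ := csInf_mem hU
  have hγα : γ ≤ α := csInf_le' fun i => (h i).le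
  have hmin : ∀ δ < γ, ∃ i, δ < β i := by
    intro δ hδ
    by_contra! hcon
    exact absurd (csInf_le' hcon : γ ≤ δ) hδ.not_ge
  by_cases hatt : ∃ i, β i = γ
  · have := Countable.toSmall {i // β i = γ}
    let e := (equivShrink.{0} {i // β i = γ})
    obtain ⟨i, hi⟩ := hatt
    exact .inr ⟨γ, hi ▸ h i, _, e.symm.injective.countable, ⟨e ⟨i, hi⟩⟩,
      ((absorbs hF hhom hiso γ).nonempty_sigma hγU ⟨i, hi⟩).homeo_trans
        (nonempty_sigma_reindex_const e _)⟩
  · push Not at hatt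
    have hlt : ∀ i, β i < γ := fun i => (hγU i).lt_of_ne (hatt i)
    have hlim : Order.IsSuccLimit γ := by
      refine ⟨not_isMin_iff.2 ⟨_, hlt hI.some⟩, fun δ hδ => ?_⟩
      obtain ⟨i, hi⟩ := hmin δ hδ.lt
      exact hδ.2 hi (hlt i)
    have := nonempty_sigma_limit hF hhom hiso hlim (hγα.trans_lt hα) hlt hmin
    rcases hγα.eq_or_lt with h1 | h1
    · exact .inl (h1 ▸ this)
    · exact .inr ⟨γ, h1, Unit, inferInstance, inferInstance,
        this.homeo_trans (nonempty_sigma_unique (X := fun _ : Unit => T F γ)).homeo_symm⟩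

end T

/-! ### Classification of the subspaces of `T_α` -/

section Subspaces

variable {F : Filter ℕ}

/-- If `γ` is the limit superior of `β` along `F`, then some positive set has the property that
`γ` is the supremum of `β` on each of its infinite subsets. -/
theorem exists_positive_of_limsup (hF : F.NeBot)
    (hstar : FiniteToOneCondition F) {γ : Ordinal.{0}} (hγ1 : γ < Ordinal.omega 1)
    {β : ℕ → Ordinal.{0}} (h : ∀ n, β n ≤ γ) (hmin : ∀ δ < γ, {n | β n ≤ δ} ∉ F) :
    ∃ A, Positive F A ∧ ∀ B ⊆ A, B.Infinite →
      {n | n ∈ B ∧ β n = γ}.Infinite ∨ Order.IsSuccLimit γ ∧ ∀ δ < γ, ∃ n ∈ B, δ < β n := by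
  classical
  by_cases hP : Positive F {n | β n = γ}
  · refine ⟨_, hP, fun B hB hBi => .inl (hBi.mono fun n hn => ⟨hn, hB hn⟩)⟩
  have hlt : {n | β n < γ} ∈ F :=
    mem_of_superset (compl_mem_of_not_positive hP) fun n hn => (h n).lt_of_ne hn
  obtain ⟨n₀, hn₀⟩ := Filter.nonempty_of_mem hlt
  have hlim : Order.IsSuccLimit γ := by
    refine ⟨not_isMin_iff.2 ⟨_, hn₀⟩, fun δ hδ => hmin δ hδ.lt ?_⟩
    filter_upwards [hlt] with n hn
    by_contra! hcon
    exact hδ.2 hcon hn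
  have := countable_Iio_of_lt hγ1
  have : Nonempty (Iio γ) := ⟨⟨_, hn₀⟩⟩
  obtain ⟨q, hq⟩ := exists_surjective_nat (Iio γ)
  have hex : ∀ n, β n < γ → ∃ k, β n ≤ q k := fun n hn => by
    obtain ⟨k, hk⟩ := hq ⟨β n, hn⟩
    exact ⟨k, by rw [hk]⟩
  -- `f n` is the first place in the enumeration `q` of the ordinals below `γ` whose term bounds `β
  -- n`. Were `f` bounded by `K` on a member of `F`, the maximum of `q 0, …, q K` would contradict
  -- the minimality of `γ`.
  let f : ℕ → ℕ := fun n => if hn : β n < γ then Nat.find (hex n hn) else 0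
  have hf : ∀ n (hn : β n < γ), β n ≤ q (f n) := fun n hn => by
    simp only [f, hn, dite_true]
    exact Nat.find_spec (hex n hn)
  have hf' : ∀ n k, β n ≤ q k → f n ≤ k := fun n k hk => by
    have hn : β n < γ := hk.trans_lt (q k).2
    simp only [f, hn, dite_true]
    exact Nat.find_min' _ hk
  obtain ⟨A, hA, hAf⟩ := hstar f fun S hS ⟨K, hK⟩ => by
    have hbd : ∀ K : ℕ, ∃ δ < γ, ∀ k ≤ K, (q k : Ordinal.{0}) ≤ δ := by
      intro K
      induction K with
      | zero => exact ⟨q 0, (q 0).2, fun k hk => by rw [Nat.le_zero.1 hk]⟩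
      | succ K ih =>
        obtain ⟨δ, hδ, h⟩ := ih
        refine ⟨max δ (q (K + 1)), max_lt hδ (q (K + 1)).2, fun k hk => ?_⟩
        rcases hk.eq_or_lt with rfl | hk
        · exact le_max_right _ _
        · exact (h k (Nat.lt_succ_iff.1 hk)).trans (le_max_left _ _)
    obtain ⟨δ, hδ, hq'⟩ := hbd K
    refine hmin δ hδ ?_
    filter_upwards [hS, hlt] with n hn hn'
    exact (hf n hn').trans (hq' _ (hK ⟨n, hn, rfl⟩))
  refine ⟨A, hA, fun B hB hBi => .inr ⟨hlim, fun δ hδ => ?_⟩⟩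
  -- If `δ = q k` bounded `β` on `B`, then `f ≤ k` there, and `B` would be finite.
  by_contra! hcon
  obtain ⟨k, hk⟩ := hq ⟨δ, hδ⟩
  refine hBi (((finite_Iic k).biUnion fun j _ => hAf j).subset fun n hn => ?_)
  simp only [mem_iUnion]
  exact ⟨f n, hf' n k (by rw [hk]; exact hcon n hn), hB hn, rfl⟩

/-- Each fibre of `ψ` meets `A` in an infinite set, so its summands add up to `ω` copies of `T_γ`.
Grouping over `F × ω` by first coordinate gives the same blocks from single copies of `T_γ`. -/
theorem nonempty_GSum_limsup (hF : F.NeBot) (hhom : Homogeneous F)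
    (hiso : FilterIso F (timesOmega F)) (hstar : FiniteToOneCondition F)
    {γ : Ordinal.{0}} (hγ1 : γ < Ordinal.omega 1)
    {β : ℕ → Ordinal.{0}} (h : ∀ n, β n ≤ γ) (hmin : ∀ δ < γ, {n | β n ≤ δ} ∉ F)
    {κ : ℕ → Type} [∀ n, Countable (κ n)] [∀ n, Nonempty (κ n)] :
    Nonempty (GSum F (fun n => Σ _ : κ n, T F (β n)) ≃ₜ T F (γ + 1)) := by
  obtain ⟨A, hA, hAB⟩ := exists_positive_of_limsup hF hstar hγ1 h hmin
  obtain ⟨ψ, hψ, hψA⟩ := hhom.exists_self_map hiso hA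
  have fibre : ∀ k, Nonempty ((Σ n : {n // ψ n = k}, Σ _ : κ n, T F (β n)) ≃ₜ
      Σ _ : ℕ, T F γ) := by
    intro k
    refine nonempty_sigma_assoc.homeo_trans ?_
    refine nonempty_sigma_omega hF hhom hiso hγ1
      (β := fun p : Σ n : {n // ψ n = k}, κ n => β p.1) (fun p => h _) ?_
    rcases hAB _ inter_subset_left (hψA k) with hi | ⟨hl, hc⟩
    · left
      refine Infinite.of_image
        (fun p : (Σ n : {n // ψ n = k}, κ n) => (p.1 : ℕ)) (hi.mono ?_)
      rintro n ⟨⟨-, hn⟩, hn'⟩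
      exact ⟨⟨⟨n, hn⟩, Classical.arbitrary _⟩, hn', rfl⟩
    · refine .inr ⟨hl, fun δ hδ => ?_⟩
      obtain ⟨n, ⟨-, hn⟩, hn'⟩ := hc δ hδ
      exact ⟨⟨⟨n, hn⟩, Classical.arbitrary _⟩, hn'⟩
  refine (GSum.nonempty_group ψ F hψ).homeo_trans ((GSum.nonempty_congr fibre).homeo_trans ?_)
  refine Nonempty.homeo_trans ?_ (nonempty_T_succ F γ).homeo_symm
  obtain ⟨e, he⟩ := hiso
  refine Nonempty.homeo_trans ?_
    (GSum.nonempty_reindex (X := fun _ : ℕ × ℕ => T F γ) e F he).homeo_symm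
  refine Nonempty.homeo_symm ((GSum.nonempty_group Prod.fst F rfl).homeo_trans ?_)
  refine GSum.nonempty_congr fun k => nonempty_sigma_reindex_const
    ⟨fun p => p.1.2, fun m => ⟨(k, m), rfl⟩, ?_, fun m => rfl⟩ _
  rintro ⟨⟨_, m⟩, rfl⟩
  rfl

theorem isMultiple_self_or {α : Ordinal.{0}} {X : Type*} [TopologicalSpace X]
    (h : IsMultiple F α X) : ∃ β ≤ α, ∃ κ : Type, Countable κ ∧ Nonempty κ ∧
      Nonempty (X ≃ₜ Σ _ : κ, T F β) := by
  rcases h with h | ⟨γ, hγ, hκ⟩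
  · exact ⟨α, le_rfl, Unit, inferInstance, inferInstance,
      h.homeo_trans (nonempty_sigma_unique (X := fun _ : Unit => T F α)).homeo_symm⟩
  · exact ⟨γ, hγ.le, hκ⟩

/-- With `γ` the limsup of `β` along `F`, the indices where `β n ≤ γ` contribute `T_{γ+1}` and the
others split off as an ordinary sum. The latter is absorbed if `γ = α`; otherwise everything is a
sum of `T`'s below `α + 1`. -/
theorem isMultiple_GSum (hF : F.NeBot) (hhom : Homogeneous F)
    (hiso : FilterIso F (timesOmega F)) (hstar : FiniteToOneCondition F)
    {α : Ordinal.{0}} (hα : α + 1 < Ordinal.omega 1)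
    {β : ℕ → Ordinal.{0}} (h : ∀ n, β n ≤ α)
    {κ : ℕ → Type} [∀ n, Countable (κ n)] [∀ n, Nonempty (κ n)] :
    IsMultiple F (α + 1) (GSum F fun n => Σ _ : κ n, T F (β n)) := by
  let U : Set Ordinal.{0} := {γ | {n | β n ≤ γ} ∈ F}
  have hαU : α ∈ U := by
    change {n | β n ≤ α} ∈ F
    simp only [h]
    exact univ_mem
  set γ := sInf U with hγ
  have hA : {n | β n ≤ γ} ∈ F := csInf_mem (s := U) ⟨α, hαU⟩
  have hγα : γ ≤ α := csInf_le' hαU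
  have hγ1 : γ < Ordinal.omega 1 := (hγα.trans_lt (Order.lt_add_one_iff.2 le_rfl)).trans hα
  have hmin : ∀ δ < γ, {n | β n ≤ δ} ∉ F := fun δ hδ hcon =>
    absurd (csInf_le' (s := U) hcon : γ ≤ δ) hδ.not_ge
  set A := {n | β n ≤ γ}
  obtain ⟨e, he⟩ := hhom A (.of_mem hA)
  have hmap : map e.symm F = comap (Subtype.val : A → ℕ) F := by
    conv_lhs => rw [← he, map_map]
    simp [restrict]
  -- Reindexing by `A` preserves `F`, so the minimality of `γ` passes to the reindexed family.
  have hcomap : map (fun n => (e.symm n : ℕ)) F = F := by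
    change map (Subtype.val ∘ e.symm) F = F
    rw [← map_map, hmap]
    exact map_comap_of_mem (by simpa using hA)
  have main : Nonempty (GSum (comap (Subtype.val : A → ℕ) F)
      (fun n => Σ _ : κ n, T F (β n)) ≃ₜ T F (γ + 1)) := by
    refine (GSum.nonempty_reindex e.symm F hmap).homeo_symm.homeo_trans ?_
    refine nonempty_GSum_limsup hF hhom hiso hstar hγ1 (β := fun n => β (e.symm n))
      (κ := fun n => κ (e.symm n)) (fun n => (e.symm n).2) fun δ hδ hcon => hmin δ hδ ?_
    rw [← hcomap]
    exact hcon
  have split := (GSum.nonempty_split (G := F) (X := fun n => Σ _ : κ n, T F (β n)) A hA).homeo_trans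
    (nonempty_sum_congr nonempty_sigma_assoc main)
  rcases hγα.eq_or_lt with hγα | hγα
  · rw [hγα] at split
    refine .inl (split.homeo_trans (Nonempty.homeo_trans ⟨Homeomorph.sumComm _ _⟩ ?_))
    exact absorbs hF hhom hiso _ _ (fun p : Σ n : {n // n ∉ A}, κ n => β p.1)
      fun p => Order.lt_add_one_iff.2 (h _)
  · let b : (Σ n : {n // n ∉ A}, κ n) ⊕ Unit → Ordinal.{0} :=
      Sum.elim (fun p => β p.1) fun _ => γ + 1
    refine IsMultiple.congr (Y := Σ i, T F (b i)) ?_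
      (isMultiple_sigma hF hhom hiso hα ?_)
    · refine split.homeo_trans (Nonempty.homeo_symm (nonempty_sigma_sum.homeo_trans ?_))
      exact nonempty_sum_congr ⟨Homeomorph.refl _⟩
        (nonempty_sigma_unique (X := fun _ : Unit => T F (γ + 1)))
    · rintro (p | _)
      · exact Order.lt_add_one_iff.2 (h _)
      · exact Order.lt_add_one_iff.2 (Order.add_one_le_iff.2 hγα)

theorem isMultiple_subspace_of_homeo {α : Ordinal.{0}} {X Y : Type*} [TopologicalSpace X]
    [TopologicalSpace Y] (e : Nonempty (X ≃ₜ Y)) (h : ∀ S : Set Y, IsMultiple F α S)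
    (S : Set X) : IsMultiple F α S := by
  obtain ⟨e⟩ := e
  exact (h (e '' S)).congr ⟨e.image S⟩

/-- Every subspace of `T_α` is homeomorphic to `T_α` or to a nonempty countable multiple of some
`T_γ` with `γ < α`. -/
theorem isMultiple_subspace (hF : F.NeBot) (hhom : Homogeneous F)
    (hiso : FilterIso F (timesOmega F)) (hstar : FiniteToOneCondition F)
    (α : Ordinal.{0}) (hα : α < Ordinal.omega 1) (S : Set (T F α)) : IsMultiple F α S := by
  induction α using Ordinal.limitRecOn with
  | zero => exact .inl ⟨Homeomorph.empty⟩
  | add_one α ih =>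
    have hα' : α < Ordinal.omega 1 := (Order.lt_add_one_iff.2 le_rfl).trans hα
    refine isMultiple_subspace_of_homeo (nonempty_T_succ F α) (fun S => ?_) S
    have hS : ∀ n : ℕ, IsMultiple F α {x : T F α | GSum.pt n x ∈ S} := fun n => ih hα' _
    choose β hβ κ hκ hκ' hX using fun n => isMultiple_self_or (hS n)
    by_cases hm : GSum.infty ∈ S
    · exact .congr ((GSum.nonempty_subspace S hm).homeo_trans (GSum.nonempty_congr hX))
        (isMultiple_GSum hF hhom hiso hstar hα hβ)
    · refine .congr ((GSum.nonempty_subspace_of_notMem S hm).homeo_trans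
        ((nonempty_sigma_congr hX).homeo_trans nonempty_sigma_assoc)) ?_
      exact isMultiple_sigma hF hhom hiso hα (β := fun p : Σ n, κ n => β p.1)
        fun p => Order.lt_add_one_iff.2 (hβ _)
  | limit α hlim ih =>
    have := countable_Iio_of_lt hα
    refine isMultiple_subspace_of_homeo (nonempty_T_limit F hlim) (fun S => ?_) S
    have hS : ∀ δ : Iio α, IsMultiple F δ.1 {x : T F δ.1 | (⟨δ, x⟩ : Σ δ : Iio α, T F δ.1) ∈ S} :=
      fun δ => ih δ δ.2 (lt_trans δ.2 hα) _
    choose β hβ κ hκ hκ' hX using fun n => isMultiple_self_or (hS n)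
    refine .congr ((nonempty_sigma_subspace S).homeo_trans
        ((nonempty_sigma_congr hX).homeo_trans nonempty_sigma_assoc)) ?_
    exact isMultiple_sigma hF hhom hiso hα (β := fun p : Σ n, κ n => β p.1)
        fun p => (hβ p.1).trans_lt p.1.2

end Subspaces

/-! ### Cantor-Bendixson ranks -/

section Rank

variable {X : Type u} {Y : Type v} [TopologicalSpace X] [TopologicalSpace Y]

theorem derivative_zero : derivative X 0 = univ := Ordinal.limitRecOn_zero ..

theorem derivative_add_one (α : Ordinal.{0}) :
    derivative X (α + 1) = {x | x ∈ derivative X α ∧ AccPt x (𝓟 (derivative X α))} :=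
  Ordinal.limitRecOn_add_one ..

theorem derivative_limit {α : Ordinal.{0}} (h : Order.IsSuccLimit α) :
    derivative X α = ⋂ β : Iio α, derivative X β.1 :=
  Ordinal.limitRecOn_limit (h := h) ..

theorem derivative_anti {α β : Ordinal.{0}} (h : α ≤ β) : derivative X β ⊆ derivative X α := by
  induction β using Ordinal.limitRecOn with
  | zero =>
    rw [le_antisymm h zero_le]
  | add_one β ih =>
    rcases h.eq_or_lt with rfl | h
    · rfl
    · rw [derivative_add_one]
      exact fun x hx => ih (Order.lt_add_one_iff.1 h) hx.1
  | limit β hβ ih =>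
    rcases h.eq_or_lt with rfl | h
    · rfl
    · rw [derivative_limit hβ]
      exact iInter_subset (fun γ : Iio β => derivative X γ.1) ⟨α, h⟩

theorem accPt_preimage_iff {f : X → Y} (hf : IsOpenEmbedding f) (x : X) (D : Set Y) :
    AccPt (f x) (𝓟 D) ↔ AccPt x (𝓟 (f ⁻¹' D)) := by
  simp only [accPt_iff_nhds]
  constructor
  · intro h U hU
    obtain ⟨_, ⟨⟨y, hy, rfl⟩, hD⟩, hne⟩ := h (f '' U) (hf.image_mem_nhds.2 hU)
    exact ⟨y, ⟨hy, hD⟩, fun h => hne (h ▸ rfl)⟩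
  · intro h U hU
    obtain ⟨y, ⟨hy, hD⟩, hne⟩ := h (f ⁻¹' U) (hf.continuous.continuousAt hU)
    exact ⟨f y, ⟨hy, hD⟩, fun h => hne (hf.injective h)⟩

/-- Accumulation is a local notion, so derivatives can be computed inside open pieces. -/
theorem preimage_derivative {f : X → Y} (hf : IsOpenEmbedding f) (α : Ordinal.{0}) :
    f ⁻¹' derivative Y α = derivative X α := by
  induction α using Ordinal.limitRecOn with
  | zero => simp [derivative_zero]
  | add_one α ih =>
    ext x
    have h : f x ∈ derivative Y α ↔ x ∈ derivative X α := Set.ext_iff.1 ih x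
    simp only [derivative_add_one, mem_preimage, mem_ofPred_eq, h, accPt_preimage_iff hf, ih]
  | limit α hα ih =>
    rw [derivative_limit hα, derivative_limit hα, preimage_iInter]
    exact iInter_congr fun β => ih β β.2

theorem derivative_homeo_eq_empty_iff (e : Nonempty (X ≃ₜ Y)) (α : Ordinal.{0}) :
    derivative X α = ∅ ↔ derivative Y α = ∅ := by
  obtain ⟨e⟩ := e
  rw [← preimage_derivative e.isOpenEmbedding, preimage_eq_empty_iff]
  simp

theorem ScatteredOfRank.congr (e : Nonempty (X ≃ₜ Y)) {α : Ordinal.{0}}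
    (h : ScatteredOfRank X α) : ScatteredOfRank Y α := by
  simpa only [ScatteredOfRank, derivative_homeo_eq_empty_iff e] using h

theorem derivative_sigma_eq_empty_iff {ι : Type*} {Z : ι → Type*} [∀ i, TopologicalSpace (Z i)]
    (α : Ordinal.{0}) : derivative (Σ i, Z i) α = ∅ ↔ ∀ i, derivative (Z i) α = ∅ := by
  simp only [eq_empty_iff_forall_notMem, Sigma.forall]
  refine forall_congr' fun i => forall_congr' fun x => not_congr ?_
  exact Set.ext_iff.1 (preimage_derivative (IsOpenEmbedding.sigmaMk (i := i)) α) x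

theorem scatteredOfRank_multiple {κ : Type*} [Nonempty κ] {α : Ordinal.{0}}
    (h : ScatteredOfRank X α) : ScatteredOfRank (Σ _ : κ, X) α := by
  simpa only [ScatteredOfRank, derivative_sigma_eq_empty_iff, forall_const] using h

/-- Every neighbourhood of `∞` contains a whole copy of `X`, so `∞` survives a derivative step
whenever the corresponding derivative of `X` is nonempty. -/
theorem infty_mem_derivative {F : Filter ℕ} (hF : F.NeBot) {α γ : Ordinal.{0}}
    (h : ∀ δ < α, (derivative X δ).Nonempty) (hγ : γ ≤ α) :
    GSum.infty ∈ derivative (GSum F fun _ : ℕ => X) γ := by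
  induction γ using Ordinal.limitRecOn with
  | zero => simp [derivative_zero]
  | add_one γ ih =>
    rw [derivative_add_one]
    have hlt : γ < α := Order.add_one_le_iff.1 hγ
    refine ⟨ih hlt.le, accPt_iff_nhds.2 fun U hU => ?_⟩
    obtain ⟨V, hVU, hV, hm⟩ := mem_nhds_iff.1 hU
    obtain ⟨S, hS, hSV⟩ := (GSum.isOpen_iff.1 hV).2 hm
    obtain ⟨n, hn⟩ := hF.nonempty_of_mem hS
    obtain ⟨x, hx⟩ := h γ hlt
    rw [← preimage_derivative (GSum.isOpenEmbedding_pt (G := F) (X := fun _ : ℕ => X) n)] at hx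
    exact ⟨_, ⟨hVU (hSV n hn x), hx⟩, by simp⟩
  | limit γ hlim ih =>
    rw [derivative_limit hlim]
    exact mem_iInter.2 fun β => ih β β.2 (le_of_lt (lt_of_lt_of_le β.2 hγ))

theorem ScatteredOfRank.GSum {F : Filter ℕ} (hF : F.NeBot) {α : Ordinal.{0}}
    (h : ScatteredOfRank X α) : ScatteredOfRank (GSum F fun _ : ℕ => X) (α + 1) := by
  have hne : ∀ δ < α, (derivative X δ).Nonempty := fun δ hδ =>
    nonempty_iff_ne_empty.2 fun hcon => hδ.not_ge (h.2 hcon)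
  have hpt : ∀ n x γ, GSum.pt n x ∈ derivative (TorontoSpaces.GSum F fun _ : ℕ => X) γ ↔
      x ∈ derivative X γ := fun n x γ =>
    Set.ext_iff.1 (preimage_derivative
      (GSum.isOpenEmbedding_pt (G := F) (X := fun _ : ℕ => X) n) γ) x
  have hα : derivative X α = ∅ := h.1
  refine ⟨?_, fun γ hγ => ?_⟩
  · refine eq_empty_iff_forall_notMem.2 ?_
    rintro (_ | ⟨n, x⟩) hx
    -- At stage `α` only `∞` can remain, and it is then isolated.
    · rw [derivative_add_one] at hx
      obtain ⟨y, ⟨-, hy⟩, hne⟩ := accPt_iff_nhds.1 hx.2 univ univ_mem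
      rcases y with _ | ⟨n, y⟩
      · exact hne rfl
      · rw [hpt, hα] at hy
        exact hy
    · have := derivative_anti (Order.lt_add_one_iff.2 le_rfl).le hx
      rw [hpt, hα] at this
      exact this
  · rw [Order.add_one_le_iff]
    by_contra! hcon
    have := infty_mem_derivative hF hne hcon
    exact eq_empty_iff_forall_notMem.1 hγ _ this

end Rank

variable {F : Filter ℕ}

theorem scatteredOfRank_T (hF : F.NeBot) (α : Ordinal.{0}) : ScatteredOfRank (T F α) α := by
  induction α using Ordinal.limitRecOn with
  | zero => exact ⟨eq_empty_of_isEmpty _, fun _ _ => zero_le⟩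
  | add_one α ih => exact (ih.GSum hF).congr (nonempty_T_succ F α).homeo_symm
  | limit α hα ih =>
    refine ScatteredOfRank.congr (nonempty_T_limit F hα).homeo_symm ⟨?_, fun γ hγ => ?_⟩
    · refine (derivative_sigma_eq_empty_iff α).2 fun β => ?_
      exact subset_empty_iff.1 ((derivative_anti (le_of_lt β.2)).trans_eq (ih β β.2).1)
    · have h := (derivative_sigma_eq_empty_iff γ).1 hγ
      -- For `δ < α` the summand `T_{δ+1}` forces `δ + 1 ≤ γ`.
      refine le_of_forall_lt fun δ hδ => ?_
      exact Order.add_one_le_iff.1 ((ih _ (hα.add_one_lt hδ)).2 (h ⟨δ + 1, hα.add_one_lt hδ⟩))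

theorem countable_T (α : Ordinal.{0}) (hα : α < Ordinal.omega 1) : Countable (T F α) := by
  induction α using Ordinal.limitRecOn with
  | zero => infer_instance
  | add_one α ih =>
    have := ih ((Order.lt_add_one_iff.2 le_rfl).trans hα)
    obtain ⟨e⟩ := nonempty_T_succ F α
    let f : GSum F (fun _ : ℕ => T F α) → Option (ℕ × T F α)
      | .infty => none
      | .pt n x => some (n, x)
    refine (Function.Injective.countable (f := f) ?_ : Countable (GSum F fun _ : ℕ => T F α)).of_equiv
      _ e.symm.toEquiv
    rintro (_ | ⟨n, x⟩) (_ | ⟨m, y⟩) h <;> simp_all [f]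
  | limit α hlim ih =>
    have := countable_Iio_of_lt hα
    have : ∀ β : Iio α, Countable (T F β.1) := fun β => ih β β.2 (lt_trans β.2 hα)
    obtain ⟨e⟩ := nonempty_T_limit F hlim
    exact Countable.of_equiv _ e.symm.toEquiv

end TorontoSpaces

theorem theorem2p11 (F : Filter ℕ) (hF : F.NeBot)
    (hhom : TorontoSpaces.Homogeneous F)
    (hiso : TorontoSpaces.FilterIso F (TorontoSpaces.timesOmega F))
    (hstar : TorontoSpaces.FiniteToOneCondition F)
    (α : Ordinal.{0}) (hα : α < Ordinal.omega 1) :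
    (Countable (TorontoSpaces.T F α) ∧ TorontoSpaces.IsToronto (TorontoSpaces.T F α) α) ∧
    ∀ β < α, ∀ S : Set (TorontoSpaces.T F α), TorontoSpaces.ScatteredOfRank S β →
      ∃ κ : Type, Countable κ ∧ Nonempty (S ≃ₜ (Σ _ : κ, TorontoSpaces.T F β)) := by
  have hrank := TorontoSpaces.scatteredOfRank_T hF
  have hsub := TorontoSpaces.isMultiple_subspace hF hhom hiso hstar α hα
  refine ⟨⟨TorontoSpaces.countable_T α hα, hrank α, fun S hS => ?_⟩, fun β hβ S hS => ?_⟩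
  -- A nonempty multiple of `T_γ` has rank `γ`, so uniqueness of rank leaves one admissible
  -- alternative here and in the next case.
  · rcases hsub S with h | ⟨γ, hγ, κ, -, hκ, h⟩
    · exact h.homeo_symm
    · have := (hS.congr h).unique (TorontoSpaces.scatteredOfRank_multiple (hrank γ))
      exact absurd this hγ.ne'
  · rcases hsub S with h | ⟨γ, hγ, κ, hκ', hκ, h⟩
    · exact absurd ((hS.congr h).unique (hrank α)) hβ.ne
    · obtain rfl := (hS.congr h).unique (TorontoSpaces.scatteredOfRank_multiple (hrank γ))
      exact ⟨κ, hκ', h⟩
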